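/- Let $\kappa$ be an infinite cardinal, identified with its initial ordinal. Let $\mathcal D=\{0,1\}^{<\kappa}$ be the tree of all families $s=(a_\xi)_{\xi<\eta}$ with $\eta<\kappa$ an ordinal and $a_\xi\in\{0,1\}$; we write $\mathrm{lev}(s)=\eta$ and order $\mathcal D$ by the initial segment ordering $\le$. A *segment* is a linearly ordered subset $\mathcal I\subset\mathcal D$ such that $t\in\mathcal I$ whenever $s<t<s'$ with $s,s'\in\mathcal I$. A non-empty segment $\mathcal I$ is an *$\eta_1$-$\eta_2$ segment* if $\eta_1$ is the least level of an element of $\mathcal I$ and $\eta_2$ is the least level of a node $s'\in\mathcal D$ with $s\le s'$ for all $s\in\mathcal I$ (such an $s'$ being required to exist). A finite family $\{\mathcal I_j\}_{j=1}^r$ of segments is *admissible* if it is pairwise disjoint and there are ordinals $\eta_1<\eta_2$ such that every $\mathcal I_j$ is an $\eta_1$-$\eta_2$ segment. For a finitely supported $x:\mathcal D\to\mathbb R$ put $$\|x\|=\sup\Big(\sum_{j=1}^r\Big|\sum_{s\in\mathcal I_j}x(s)\Big|^2\Big)^{1/2},$$ the supremum being over all finite admissible families, and let $X_\kappa$ be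 the completion of $(c_{00}(\mathcal D),\|\cdot\|)$. For a branch $B=(a_\xi)_{\xi<\kappa}\in\Gamma=\{0,1\}^\kappa$ let $B^*\in X_\kappa^*$ be the continuous extension of the functional $x\mapsto\sum_{\eta<\kappa}x\big((a_\xi)_{\xi<\eta}\big)$ on $c_{00}(\mathcal D)$, and let $\Gamma^*=\{B^*\mid B\in\Gamma\}\subset X_\kappa^*$. A subset $A$ of a real Banach space is *equivalent to the usual $\ell_1(\lambda)$-basis* if $|A|=\lambda$ and there are constants $C_1,C_2>0$ such that $C_1\sum_{i=1}^n|a_i|\le\big\|\sum_{i=1}^n a_ix_i\big\|\le C_2\sum_{i=1}^n|a_i|$ for all $n\in\mathbb N$, all distinct $x_1,\dots,x_n\in A$ and all real scalars $a_1,\dots,a_n$. **Theorem.** There exists no subset of $\Gamma^*$ which is equivalent to the usual $\ell_1(\kappa^+)$-basis. -/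

import Mathlib

open Cardinal

universe u

noncomputable section

namespace TreeSpace

/-- A node of the standard tree `{0,1}^{<κ}`: a `{0,1}`-valued family indexed by the ordinals
below some ordinal `lev < κ`.  (The cardinal `κ` is identified with its initial ordinal.) -/
structure Node (κ : Cardinal.{u}) : Type (u + 1) where
  lev : Ordinal.{u}
  lev_lt : lev < κ.ord
  val : Set.Iio lev → Bool

/-- The set `Γ = {0,1}^κ` of branches. -/
abbrev Branch (κ : Cardinal.{u}) : Type (u + 1) := Set.Iio κ.ord → Bool

variable {κ : Cardinal.{u}}

/-- The initial segment partial ordering on the tree. -/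
instance : PartialOrder (Node κ) where
  le s t := ∃ h : s.lev ≤ t.lev, ∀ ξ : Set.Iio s.lev, s.val ξ = t.val ⟨ξ.1, lt_of_lt_of_le ξ.2 h⟩
  le_refl s := ⟨le_rfl, fun _ => rfl⟩
  le_trans s t w := fun ⟨h₁, h₂⟩ ⟨h₃, h₄⟩ =>
    ⟨h₁.trans h₃, fun ξ => (h₂ ξ).trans (h₄ ⟨ξ.1, lt_of_lt_of_le ξ.2 h₁⟩)⟩
  le_antisymm := by
    rintro ⟨a, ha, f⟩ ⟨b, hb, g⟩ ⟨h₁, h₂⟩ ⟨h₃, h₄⟩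
    obtain rfl : a = b := le_antisymm h₁ h₃
    congr
    funext ξ
    exact h₂ ξ

/-- A segment: a linearly ordered set of nodes that contains every node between two of its
elements. -/
def IsSegment (I : Set (Node κ)) : Prop :=
  IsChain (· ≤ ·) I ∧ ∀ s ∈ I, ∀ s' ∈ I, ∀ t, s < t → t < s' → t ∈ I

/-- `I` is an `η₁`-`η₂` segment: a non-empty segment such that `η₁` is the least level of a node
of `I`, and `η₂` is the least level of a node `s'` with `s ≤ s'` for all `s ∈ I`. -/
def IsSegmentFromTo (η₁ η₂ : Ordinal.{u}) (I : Set (Node κ)) : Prop :=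
  IsSegment I ∧ I.Nonempty ∧
    IsLeast {η | ∃ s : Node κ, s.lev = η ∧ s ∈ I} η₁ ∧
    IsLeast {η | ∃ s' : Node κ, s'.lev = η ∧ ∀ s ∈ I, s ≤ s'} η₂

/-- A finite family of segments is admissible if its members are pairwise disjoint
`η₁`-`η₂` segments for the same ordinals `η₁ < η₂`. -/
def IsAdmissible {r : ℕ} (I : Fin r → Set (Node κ)) : Prop :=
  (∃ η₁ η₂ : Ordinal.{u}, η₁ < η₂ ∧ ∀ j, IsSegmentFromTo η₁ η₂ (I j)) ∧
    ∀ i j, i ≠ j → I i ∩ I j = ∅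

/-- The vector space `c₀₀(𝒟)` of finitely supported real functions on the tree. -/
def C00 (κ : Cardinal.{u}) : Type (u + 1) := Node κ →₀ ℝ

instance : AddCommGroup (C00 κ) := inferInstanceAs (AddCommGroup (Node κ →₀ ℝ))

instance : Module ℝ (C00 κ) := inferInstanceAs (Module ℝ (Node κ →₀ ℝ))

/-- The coordinate `x(s)`. -/
def C00.coeff (x : C00 κ) (s : Node κ) : ℝ := DFunLike.coe (F := Node κ →₀ ℝ) x s

/-- The finite support of `x`. -/
def C00.supp (x : C00 κ) : Finset (Node κ) := Finsupp.support (M := ℝ) x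

/-- The functional `I^*(x) = ∑_{s ∈ I} x(s)` on `c₀₀(𝒟)`. -/
def segFun (I : Set (Node κ)) : C00 κ →ₗ[ℝ] ℝ :=
  Finsupp.linearCombination ℝ (I.indicator fun _ => (1 : ℝ))

theorem segFun_apply (I : Set (Node κ)) [DecidablePred (· ∈ I)] (x : C00 κ) :
    segFun I x = ∑ s ∈ x.supp with s ∈ I, x.coeff s := by
  have : segFun I x = ∑ s ∈ x.supp, x.coeff s • I.indicator (fun _ => (1 : ℝ)) s :=
    Finsupp.linearCombination_apply (M := ℝ) ℝ x
  rw [this, Finset.sum_filter]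
  refine Finset.sum_congr rfl fun s _ => ?_
  by_cases h : s ∈ I <;> simp [h]

/-- The values `(∑_j |I_j^*(x)|²)^{1/2}` over all finite admissible families. -/
def admissibleValues (x : C00 κ) : Set ℝ :=
  {y | ∃ (r : ℕ) (I : Fin r → Set (Node κ)),
    IsAdmissible I ∧ y = √(∑ j, |segFun (I j) x| ^ 2)}

/-- The norm of `c₀₀(𝒟)`: the supremum of `(∑_j |I_j^*(x)|²)^{1/2}` over all finite admissible
families of segments. -/
instance : Norm (C00 κ) := ⟨fun x => sSup (admissibleValues x)⟩

theorem norm_def (x : C00 κ) : ‖x‖ = sSup (admissibleValues x) := rfl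

theorem bddAbove_admissibleValues (x : C00 κ) : BddAbove (admissibleValues x) := by
  classical
  refine ⟨∑ s ∈ x.supp, |x.coeff s|, ?_⟩
  rintro _ ⟨r, I, hI, rfl⟩
  have h1 : √(∑ j, |segFun (I j) x| ^ 2) ≤ ∑ j, |segFun (I j) x| := by
    rw [Real.sqrt_le_left (Finset.sum_nonneg fun _ _ => abs_nonneg _)]
    exact Finset.sum_sq_le_sq_sum_of_nonneg fun _ _ => abs_nonneg _
  refine h1.trans ?_
  have h2 : ∀ j, |segFun (I j) x| ≤
      ∑ s ∈ x.supp, if s ∈ I j then |x.coeff s| else 0 := by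
    intro j
    rw [segFun_apply, ← Finset.sum_filter]
    exact Finset.abs_sum_le_sum_abs _ _
  refine (Finset.sum_le_sum fun j _ => h2 j).trans ?_
  rw [Finset.sum_comm]
  refine Finset.sum_le_sum fun s _ => ?_
  by_cases hs : ∃ j, s ∈ I j
  · obtain ⟨j, hj⟩ := hs
    rw [Finset.sum_eq_single j]
    · simp [hj]
    · intro i _ hij
      rw [if_neg]
      intro hi
      have : s ∈ I i ∩ I j := ⟨hi, hj⟩
      rw [hI.2 i j hij] at this
      exact this
    · simp
  · push Not at hs
    simp [hs]

theorem isAdmissible_empty (I : Fin 0 → Set (Node κ)) : IsAdmissible I :=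
  ⟨⟨0, 1, zero_lt_one, fun j => j.elim0⟩, fun j => j.elim0⟩

theorem admissibleValues_nonempty (x : C00 κ) : (admissibleValues x).Nonempty :=
  ⟨_, 0, fun j => j.elim0, isAdmissible_empty _, rfl⟩

theorem le_norm (x : C00 κ) {r : ℕ} {I : Fin r → Set (Node κ)} (hI : IsAdmissible I) :
    √(∑ j, |segFun (I j) x| ^ 2) ≤ ‖x‖ :=
  le_csSup (bddAbove_admissibleValues x) ⟨r, I, hI, rfl⟩

theorem norm_le_of_forall {x : C00 κ} {c : ℝ} (h : ∀ (r : ℕ) (I : Fin r → Set (Node κ)),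
    IsAdmissible I → √(∑ j, |segFun (I j) x| ^ 2) ≤ c) : ‖x‖ ≤ c := by
  refine csSup_le (admissibleValues_nonempty x) ?_
  rintro _ ⟨r, I, hI, rfl⟩
  exact h r I hI

theorem c00_norm_nonneg (x : C00 κ) : 0 ≤ ‖x‖ :=
  (Real.sqrt_nonneg _).trans (le_norm x (isAdmissible_empty fun j => j.elim0))

theorem c00_norm_smul_le (c : ℝ) (x : C00 κ) : ‖c • x‖ ≤ ‖c‖ * ‖x‖ := by
  refine norm_le_of_forall fun r I hI => ?_
  have : ∑ j, |segFun (I j) (c • x)| ^ 2 = |c| ^ 2 * ∑ j, |segFun (I j) x| ^ 2 := by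
    rw [Finset.mul_sum]
    refine Finset.sum_congr rfl fun j _ => ?_
    rw [map_smul, smul_eq_mul, abs_mul, mul_pow]
  rw [this, Real.sqrt_mul (by positivity), Real.sqrt_sq (abs_nonneg c), Real.norm_eq_abs]
  exact mul_le_mul_of_nonneg_left (le_norm x hI) (abs_nonneg c)

theorem c00_norm_core : SeminormedSpace.Core ℝ (C00 κ) where
  norm_nonneg := c00_norm_nonneg
  norm_smul c x := by
    refine le_antisymm (c00_norm_smul_le c x) ?_
    rcases eq_or_ne c 0 with rfl | hc
    · simpa using c00_norm_nonneg ((0 : ℝ) • x)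
    · have h := c00_norm_smul_le c⁻¹ (c • x)
      rw [smul_smul, inv_mul_cancel₀ hc, one_smul, norm_inv] at h
      have hc' : 0 < ‖c‖ := norm_pos_iff.2 hc
      calc ‖c‖ * ‖x‖ ≤ ‖c‖ * (‖c‖⁻¹ * ‖c • x‖) := mul_le_mul_of_nonneg_left h hc'.le
        _ = ‖c • x‖ := by rw [← mul_assoc, mul_inv_cancel₀ hc'.ne', one_mul]
  norm_triangle x y := by
    refine norm_le_of_forall fun r I hI => ?_
    have key := norm_add_le (WithLp.toLp 2 fun j => segFun (I j) x : EuclideanSpace ℝ (Fin r))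
      (WithLp.toLp 2 fun j => segFun (I j) y)
    rw [← WithLp.toLp_add, EuclideanSpace.norm_eq, EuclideanSpace.norm_eq,
      EuclideanSpace.norm_eq] at key
    simp only [Pi.add_apply, Real.norm_eq_abs] at key
    simp only [map_add]
    exact key.trans (add_le_add (le_norm x hI) (le_norm y hI))

instance : SeminormedAddCommGroup (C00 κ) := SeminormedAddCommGroup.ofCore c00_norm_core

instance : NormedSpace ℝ (C00 κ) where
  norm_smul_le := c00_norm_smul_le

/-- The set of nodes `s_η = (a_ξ)_{ξ<η}`, `η < κ`, of a branch `(a_ξ)_{ξ<κ}`, a maximal segment of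
the tree. -/
def Branch.nodes (B : Branch κ) : Set (Node κ) :=
  {s | ∀ ξ : Set.Iio s.lev, s.val ξ = B ⟨ξ.1, lt_trans ξ.2 s.lev_lt⟩}

/-- The node of the branch `B` on level `η`. -/
def Branch.node (B : Branch κ) (η : Ordinal.{u}) (hη : η < κ.ord) : Node κ :=
  ⟨η, hη, fun ξ => B ⟨ξ.1, lt_trans ξ.2 hη⟩⟩

theorem Branch.le_of_lev_le {B : Branch κ} {s t : Node κ} (hs : s ∈ B.nodes) (ht : t ∈ B.nodes)
    (h : s.lev ≤ t.lev) : s ≤ t :=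
  ⟨h, fun ξ => (hs ξ).trans (ht ⟨ξ.1, lt_of_lt_of_le ξ.2 h⟩).symm⟩

theorem Branch.mem_of_le {B : Branch κ} {s t : Node κ} (ht : t ∈ B.nodes) (h : s ≤ t) :
    s ∈ B.nodes :=
  fun ξ => (h.2 ξ).trans (ht ⟨ξ.1, lt_of_lt_of_le ξ.2 h.1⟩)

/-- The part of a branch between the levels `η₁` and `η₂` is an `η₁`-`η₂` segment. -/
theorem Branch.isSegmentFromTo (B : Branch κ) {η₁ η₂ : Ordinal.{u}} (h : η₁ ≤ η₂)
    (hη : η₂ < κ.ord) :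
    IsSegmentFromTo η₁ η₂ {s | s ∈ B.nodes ∧ η₁ ≤ s.lev ∧ s.lev ≤ η₂} := by
  have m₁ : B.node η₁ (h.trans_lt hη) ∈ {s | s ∈ B.nodes ∧ η₁ ≤ s.lev ∧ s.lev ≤ η₂} :=
    ⟨fun _ => rfl, le_rfl, h⟩
  have m₂ : B.node η₂ hη ∈ {s | s ∈ B.nodes ∧ η₁ ≤ s.lev ∧ s.lev ≤ η₂} :=
    ⟨fun _ => rfl, h, le_rfl⟩
  refine ⟨⟨?_, ?_⟩, ⟨_, m₁⟩, ⟨⟨_, rfl, m₁⟩, ?_⟩,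
    ⟨⟨B.node η₂ hη, rfl, ?_⟩, ?_⟩⟩
  · intro s hs t ht _
    rcases le_total s.lev t.lev with h' | h'
    · exact Or.inl (le_of_lev_le hs.1 ht.1 h')
    · exact Or.inr (le_of_lev_le ht.1 hs.1 h')
  · intro s hs s' hs' t hst hts'
    exact ⟨mem_of_le hs'.1 hts'.le, hs.2.1.trans hst.le.1, hts'.le.1.trans hs'.2.2⟩
  · rintro _ ⟨s, rfl, hs⟩
    exact hs.2.1
  · intro s hs
    exact le_of_lev_le hs.1 m₂.1 hs.2.2
  · rintro _ ⟨s', rfl, hs'⟩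
    exact (hs' _ m₂).1

theorem Branch.abs_segFun_le_norm (B : Branch κ) {η₁ η₂ : Ordinal.{u}} (h : η₁ < η₂)
    (hη : η₂ < κ.ord) (x : C00 κ) :
    |segFun {s | s ∈ B.nodes ∧ η₁ ≤ s.lev ∧ s.lev ≤ η₂} x| ≤ ‖x‖ := by
  have hI : IsAdmissible (fun _ : Fin 1 => {s | s ∈ B.nodes ∧ η₁ ≤ s.lev ∧ s.lev ≤ η₂}) :=
    ⟨⟨η₁, η₂, h, fun _ => B.isSegmentFromTo h.le hη⟩,
      fun i j hij => absurd (Subsingleton.elim i j) hij⟩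
  have := le_norm x hI
  simpa [Real.sqrt_sq_eq_abs] using this

/-- The levels of the nodes in a finite set are bounded by a level, when `κ` is infinite. -/
theorem exists_level_bound (hκ : ℵ₀ ≤ κ) (F : Finset (Node κ)) :
    ∃ η : Ordinal.{u}, η < κ.ord ∧ ∀ s ∈ F, s.lev < η := by
  classical
  have hlim := isSuccLimit_ord hκ
  induction F using Finset.induction_on with
  | empty => exact ⟨0, hlim.bot_lt, by simp⟩
  | insert s F _ ih =>
    obtain ⟨η, h1, h2⟩ := ih
    refine ⟨max η (Order.succ s.lev), max_lt h1 (hlim.succ_lt s.lev_lt), ?_⟩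
    intro t ht
    rcases Finset.mem_insert.1 ht with rfl | ht
    · exact (Order.lt_succ _).trans_le (le_max_right _ _)
    · exact (h2 t ht).trans_le (le_max_left _ _)

/-- For infinite `κ` the seminorm above is a norm. -/
theorem eq_zero_of_norm_eq_zero (hκ : ℵ₀ ≤ κ) {x : C00 κ} (hx : ‖x‖ = 0) : x = 0 := by
  classical
  by_contra hne
  have hne' : x.supp.Nonempty := Finsupp.support_nonempty_iff (M := ℝ) |>.2 hne
  obtain ⟨s, hs, hmax⟩ := Finset.exists_max_image x.supp Node.lev hne'
  let B : Branch κ := fun ξ => if h : ξ.1 < s.lev then s.val ⟨ξ.1, h⟩ else false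
  have hsB : s ∈ B.nodes := fun ξ => by
    have : ξ.1 < s.lev := ξ.2
    simp [B, this]
  have h := B.abs_segFun_le_norm (Order.lt_succ s.lev)
    ((isSuccLimit_ord hκ).succ_lt s.lev_lt) x
  rw [hx, segFun_apply, Finset.sum_eq_single s] at h
  · exact (Finsupp.mem_support_iff (M := ℝ)).1 hs (abs_nonpos_iff.1 h)
  · intro t ht hts
    obtain ⟨ht1, ht2, ht3, -⟩ := Finset.mem_filter.1 ht
    have hlev : t.lev = s.lev := le_antisymm (hmax t ht1) ht3
    exact absurd (le_antisymm (B.le_of_lev_le ht2 hsB hlev.le)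
      (B.le_of_lev_le hsB ht2 hlev.ge)) hts
  · intro hns
    exact absurd (Finset.mem_filter.2 ⟨hs, hsB, le_rfl, Order.le_succ _⟩) hns

/-- The space `X_κ`: the completion of `c₀₀(𝒟)`. -/
abbrev X (κ : Cardinal.{u}) : Type (u + 1) := UniformSpace.Completion (C00 κ)

theorem Branch.abs_le_norm (hκ : ℵ₀ ≤ κ) (B : Branch κ) (x : C00 κ) :
    |segFun B.nodes x| ≤ ‖x‖ := by
  classical
  obtain ⟨η, hη, hF⟩ := exists_level_bound hκ x.supp
  have h := B.abs_segFun_le_norm ((zero_le (a := η)).trans_lt (Order.lt_succ η)) ((isSuccLimit_ord hκ).succ_lt hη) x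
  convert h using 2
  rw [segFun_apply, segFun_apply]
  refine Finset.sum_congr (Finset.filter_congr fun s hs => ?_) fun _ _ => rfl
  exact ⟨fun h' => ⟨h', zero_le, (hF s hs).le.trans (Order.le_succ η)⟩, fun h' => h'.1⟩

/-- The functional `B^*` on `c₀₀(𝒟)`, as a continuous linear functional. -/
def Branch.preFunctional (hκ : ℵ₀ ≤ κ) (B : Branch κ) : C00 κ →L[ℝ] ℝ :=
  (segFun B.nodes).mkContinuous 1 fun x => by simpa using B.abs_le_norm hκ x

/-- The functional `B^*` on `X_κ`: the continuous extension of `x ↦ ∑_{s ∈ B} x(s)`. -/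
def Branch.functional (hκ : ℵ₀ ≤ κ) (B : Branch κ) : StrongDual ℝ (X κ) :=
  (B.preFunctional hκ).extend UniformSpace.Completion.toComplL

theorem Branch.functional_coe (hκ : ℵ₀ ≤ κ) (B : Branch κ) (x : C00 κ) :
    B.functional hκ (x : X κ) = segFun B.nodes x :=
  ContinuousLinearMap.extend_eq (B.preFunctional hκ)
    (e := (UniformSpace.Completion.toComplL : C00 κ →L[ℝ] X κ))
    UniformSpace.Completion.denseRange_coe
    (UniformSpace.Completion.isUniformInducing_coe (C00 κ)) x

/-- The set `Γ^*` of all functionals `B^*`, `B ∈ Γ`. -/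
def gammaStar (κ : Cardinal.{u}) (hκ : ℵ₀ ≤ κ) : Set (StrongDual ℝ (X κ)) :=
  Set.range fun B : Branch κ => B.functional hκ

end TreeSpace

/-- The set `A` has cardinality `c` and is equivalent to the usual `ℓ₁(c)`-basis: there are
`C₁, C₂ > 0` such that `C₁ ∑ |aᵢ| ≤ ‖∑ aᵢ xᵢ‖ ≤ C₂ ∑ |aᵢ|` for all finitely many
(distinct) elements `xᵢ` of `A` and all scalars `aᵢ`. -/
def IsEquivalentToL1Basis {E : Type*} [NormedAddCommGroup E] [NormedSpace ℝ E]
    (c : Cardinal) (A : Set E) : Prop :=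
  Cardinal.mk A = c ∧ ∃ C₁ C₂ : ℝ, 0 < C₁ ∧ 0 < C₂ ∧
    ∀ (n : ℕ) (x : Fin n → E), Function.Injective x → (∀ i, x i ∈ A) → ∀ a : Fin n → ℝ,
      C₁ * ∑ i, |a i| ≤ ‖∑ i, a i • x i‖ ∧ ‖∑ i, a i • x i‖ ≤ C₂ * ∑ i, |a i|

end

/-! Differences of branch functionals can be made to behave like an `ℓ₂` family. Suppose `N` pairs
of branches are such that the two branches of a pair share their node on level `k`, while different
pairs have different nodes there. In each difference `B^* - B'^*` the coordinates below `k` cancel.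
What remains above `k` comes from two admissible families of `N` segments, so by Cauchy-Schwarz the
sum of the `N` differences has norm at most `2√N`. A lower `ℓ₁` estimate with constant `C₁` forces
norm at least `2 C₁ N`, which is impossible for large `N`.

Such pairs exist among more than `κ` branches. Give each branch the least level on which its node
separates it from all the others. Only `κ` values are possible, so infinitely many branches share
one value `m`. Any `2N` of these occupy at least `N` nodes on some level `k < m`
(`exists_level_half_distinct`), and by minimality of `m` each of these nodes lies on a second branch
of the set. -/

namespace TreeSpace

variable {κ : Cardinal.{u}}

/-- Two branches agree below the level `k` if they pass through the same node of level `k`. -/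
def Branch.AgreeBelow (k : Ordinal.{u}) (B B' : Branch κ) : Prop :=
  ∀ ξ : Set.Iio κ.ord, ξ.1 < k → B ξ = B' ξ

theorem Branch.AgreeBelow.symm {k : Ordinal.{u}} {B B' : Branch κ} (h : B.AgreeBelow k B') :
    B'.AgreeBelow k B := fun ξ hξ => (h ξ hξ).symm

theorem Branch.AgreeBelow.trans {k : Ordinal.{u}} {B B' B'' : Branch κ}
    (h : AgreeBelow k B B') (h' : AgreeBelow k B' B'') : AgreeBelow k B B'' :=
  fun ξ hξ => (h ξ hξ).trans (h' ξ hξ)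

theorem Branch.AgreeBelow.mem_nodes {k : Ordinal.{u}} {B B' : Branch κ} (h : AgreeBelow k B B')
    {s : Node κ} (hs : s ∈ B.nodes) (hk : s.lev ≤ k) : s ∈ B'.nodes :=
  fun ξ => (hs ξ).trans (h _ (lt_of_lt_of_le ξ.2 hk))

theorem Branch.agreeBelow_of_mem_nodes {k : Ordinal.{u}} {B B' : Branch κ} {s : Node κ}
    (hs : s ∈ B.nodes) (hs' : s ∈ B'.nodes) (hk : k ≤ s.lev) : AgreeBelow k B B' :=
  fun ξ hξ => (hs ⟨ξ.1, hξ.trans_le hk⟩).symm.trans (hs' ⟨ξ.1, hξ.trans_le hk⟩)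

/-! ### Combinatorics: pairs of branches through distinct nodes -/

/-- Finitely many branches that pairwise differ below `m` occupy, on some level `k < m`, at least
half as many nodes. -/
theorem exists_level_half_distinct {α : Type*} {b : α → Branch κ} {m : Ordinal.{u}}
    {F : Finset α} (hF : (F : Set α).Pairwise fun x y => ¬ Branch.AgreeBelow m (b x) (b y))
    {N : ℕ} (hN : 0 < N) (hcard : 2 * N ≤ F.card) :
    ∃ k < m, k < κ.ord ∧ ∃ f : Fin N → α, (∀ i, f i ∈ F) ∧
      ∀ i j, i ≠ j → ¬ Branch.AgreeBelow k (b (f i)) (b (f j)) := by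
  classical
  have hd : ∀ p : α × α, ∃ ξ : Set.Iio κ.ord, p ∈ F.offDiag → ξ.1 < m ∧ b p.1 ξ ≠ b p.2 ξ := by
    intro p
    by_cases hp : p ∈ F.offDiag
    · have hp' := Finset.mem_offDiag.1 hp
      have := hF hp'.1 hp'.2.1 hp'.2.2
      unfold Branch.AgreeBelow at this
      push Not at this
      obtain ⟨ξ, h⟩ := this
      exact ⟨ξ, fun _ => h⟩
    -- The value here is irrelevant; two distinct branches only serve to show that some level
    -- exists.
    · obtain ⟨x, hx, y, hy, hxy⟩ := Finset.one_lt_card.1 (show 1 < F.card by omega)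
      have := hF hx hy hxy
      unfold Branch.AgreeBelow at this
      push Not at this
      obtain ⟨ξ, -⟩ := this
      exact ⟨ξ, fun h => absurd h hp⟩
  choose δ hδ using hd
  obtain ⟨x, hx, y, hy, hxy⟩ := Finset.one_lt_card.1 (show 1 < F.card by omega)
  -- The level `k` is the largest of the chosen splitting levels. Two members of `F` that agree
  -- below `k` must then be split exactly at `k`, so the bit at `k` tells them apart and each node
  -- of level `k` carries at most two of them.
  obtain ⟨p, hp, hmax⟩ := Finset.exists_max_image F.offDiag δ
    ⟨(x, y), Finset.mem_offDiag.2 ⟨hx, hy, hxy⟩⟩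
  refine ⟨(δ p).1, (hδ p hp).1, (δ p).2, ?_⟩
  let r : α → Branch κ := fun x ξ => if ξ.1 < (δ p).1 then b x ξ else false
  have hr : ∀ x y, Branch.AgreeBelow (δ p).1 (b x) (b y) → r x = r y := by
    intro x y h
    funext ξ
    by_cases hξ : ξ.1 < (δ p).1
    · simp only [r, if_pos hξ, h ξ hξ]
    · simp only [r, if_neg hξ]
  have hr' : ∀ x y, r x = r y → Branch.AgreeBelow (δ p).1 (b x) (b y) := by
    intro x y h ξ hξ
    have := congrFun h ξ
    simpa only [r, if_pos hξ] using this
  have hle : F.card ≤ 2 * (F.image r).card := by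
    refine Finset.card_le_mul_card_image F 2 fun c _ => ?_
    have : ({a ∈ F | r a = c}).card ≤ (Finset.univ : Finset Bool).card := by
      refine Finset.card_le_card_of_injOn (fun x => b x (δ p)) (fun _ _ => Finset.mem_univ _) ?_
      intro x hx y hy hxy
      have hx := Finset.mem_filter.1 (Finset.mem_coe.1 hx)
      have hy := Finset.mem_filter.1 (Finset.mem_coe.1 hy)
      by_contra hne
      have hmem : (x, y) ∈ F.offDiag := Finset.mem_offDiag.2 ⟨hx.1, hy.1, hne⟩
      rcases (hmax _ hmem).lt_or_eq with hlt | heq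
      · exact (hδ _ hmem).2 (hr' x y (hx.2.trans hy.2.symm) _ hlt)
      · exact (hδ _ hmem).2 (by rw [heq]; exact hxy)
    simpa using this
  obtain ⟨G, hG, hGc⟩ := Finset.exists_subset_card_eq (show N ≤ (F.image r).card by omega)
  let e := (G.equivFinOfCardEq hGc).symm
  have hpre : ∀ i : Fin N, ∃ x ∈ F, r x = (e i).1 := fun i => Finset.mem_image.1 (hG (e i).2)
  choose f hfF hf using hpre
  refine ⟨f, hfF, fun i j hij h => hij ?_⟩
  apply e.injective
  apply Subtype.ext
  rw [← hf i, ← hf j, hr _ _ h]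

/-- Among more than `κ` branches there are, for every `N`, a level with `N` distinct nodes each of
which lies on two of the branches. -/
theorem exists_level_pairs (hκ : ℵ₀ ≤ κ) {α : Type (u + 1)} {b : α → Branch κ}
    (hb : Function.Injective b) (hα : Cardinal.lift.{u + 1} κ < #α) {N : ℕ} (hN : 0 < N) :
    ∃ k < κ.ord, ∃ f g : Fin N → α, (∀ i, f i ≠ g i) ∧
      (∀ i, Branch.AgreeBelow k (b (f i)) (b (g i))) ∧
      ∀ i j, i ≠ j → ¬ Branch.AgreeBelow k (b (f i)) (b (f j)) := by
  classical
  let S : α → Set Ordinal.{u} := fun x => {m | ∀ y, Branch.AgreeBelow m (b x) (b y) → y = x}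
  have hS : ∀ x, κ.ord ∈ S x := fun x y h => hb (funext fun ξ => (h ξ ξ.2).symm)
  -- The successor is needed: a branch that is a limit of other branches is separated from all of
  -- them only at `κ.ord` itself.
  let M : α → Set.Iio (Order.succ κ.ord) := fun x =>
    ⟨sInf (S x), Order.lt_succ_iff.2 (csInf_le' (hS x))⟩
  have hcard : #(Set.Iio (Order.succ κ.ord)) < #α := by
    rw [Cardinal.mk_Iio_ordinal, Order.succ_eq_add_one, Ordinal.card_add_one, card_ord, Cardinal.add_one_eq hκ]
    exact hα
  have : Infinite α := by
    rw [Cardinal.infinite_iff]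
    exact (by simpa using hκ : ℵ₀ ≤ Cardinal.lift.{u + 1} κ).trans hα.le
  obtain ⟨m, hm⟩ := Cardinal.exists_infinite_fiber M hcard
  have hmS : ∀ x ∈ M ⁻¹' {m}, sInf (S x) = m.1 := fun x hx => congrArg Subtype.val hx
  obtain ⟨F, hFsub, hFc⟩ := (Set.infinite_coe_iff.1 hm).exists_subset_card_eq (2 * N)
  obtain ⟨k, hkm, hk, f, hf, hdis⟩ := exists_level_half_distinct (b := b) (m := m.1) (F := F)
    (fun x hx y _ hxy h => hxy (by
      have : sInf (S x) ∈ S x := csInf_mem ⟨_, hS x⟩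
      rw [hmS x (hFsub hx)] at this
      exact (this y h).symm)) hN hFc.ge
  have hg : ∀ i, ∃ y, Branch.AgreeBelow k (b (f i)) (b y) ∧ y ≠ f i := by
    intro i
    have : k ∉ S (f i) := notMem_of_lt_csInf' (by rwa [hmS _ (hFsub (hf i))])
    simpa [S] using this
  choose g hg hgne using hg
  exact ⟨k, hk, f, g, fun i => (hgne i).symm, hg, hdis⟩

/-! ### Norm estimate for sums of differences -/

/-- Below `k` the two branches have the same nodes, so those terms cancel; above `η` there is no
support. -/
theorem Branch.segFun_sub_segFun {k : Ordinal.{u}} {B B' : Branch κ} (h : AgreeBelow k B B')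
    {η : Ordinal.{u}} {x : C00 κ} (hx : ∀ s ∈ x.supp, s.lev < η) :
    segFun B.nodes x - segFun B'.nodes x =
      segFun {s | s ∈ B.nodes ∧ k ≤ s.lev ∧ s.lev ≤ η} x -
        segFun {s | s ∈ B'.nodes ∧ k ≤ s.lev ∧ s.lev ≤ η} x := by
  classical
  simp only [segFun_apply, Finset.sum_filter, ← Finset.sum_sub_distrib]
  refine Finset.sum_congr rfl fun s hs => ?_
  have hη := (hx s hs).le
  by_cases hk : k ≤ s.lev
  · simp [hk, hη]
  · have : s ∈ B.nodes ↔ s ∈ B'.nodes :=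
      ⟨fun h' => h.mem_nodes h' (not_le.1 hk).le, fun h' => h.symm.mem_nodes h' (not_le.1 hk).le⟩
    simp [hk, this]

/-- Branches through distinct nodes of level `k`, cut to the levels between `k` and `η`, form an
admissible family. -/
theorem isAdmissible_branches {k η : Ordinal.{u}} (hkη : k < η) (hη : η < κ.ord) {N : ℕ}
    {B : Fin N → Branch κ} (hB : ∀ i j, i ≠ j → ¬ Branch.AgreeBelow k (B i) (B j)) :
    IsAdmissible fun i => {s | s ∈ (B i).nodes ∧ k ≤ s.lev ∧ s.lev ≤ η} := by
  refine ⟨⟨k, η, hkη, fun i => (B i).isSegmentFromTo hkη.le hη⟩, fun i j hij => ?_⟩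
  refine Set.eq_empty_of_forall_notMem fun s hs => hB i j hij ?_
  exact Branch.agreeBelow_of_mem_nodes hs.1.1 hs.2.1 hs.1.2.1

theorem IsAdmissible.sum_abs_le {N : ℕ} {I : Fin N → Set (Node κ)} (hI : IsAdmissible I)
    (x : C00 κ) : ∑ i, |segFun (I i) x| ≤ √N * ‖x‖ := by
  have h := Real.sum_mul_le_sqrt_mul_sqrt Finset.univ (fun _ : Fin N => (1 : ℝ))
    fun i => |segFun (I i) x|
  simp only [one_mul, one_pow, Finset.sum_const, Finset.card_univ, Fintype.card_fin,
    nsmul_eq_mul, mul_one] at h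
  exact h.trans (mul_le_mul_of_nonneg_left (le_norm x hI) (Real.sqrt_nonneg _))

/-- The branches `B i`, cut to levels at least `k`, form one admissible family and the `B' i`
another; each contributes `√N`. -/
theorem norm_sum_functional_sub_le (hκ : ℵ₀ ≤ κ) {k : Ordinal.{u}} (hk : k < κ.ord) {N : ℕ}
    {B B' : Fin N → Branch κ} (hBB' : ∀ i, Branch.AgreeBelow k (B i) (B' i))
    (hB : ∀ i j, i ≠ j → ¬ Branch.AgreeBelow k (B i) (B j)) :
    ‖∑ i, ((B i).functional hκ - (B' i).functional hκ)‖ ≤ 2 * √N := by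
  refine ContinuousLinearMap.opNorm_le_bound _ (by positivity) fun x => ?_
  induction x using UniformSpace.Completion.induction_on with
  | hp => exact isClosed_le (by fun_prop) (by fun_prop)
  | ih x =>
    obtain ⟨η, hη, hx⟩ := exists_level_bound hκ x.supp
    have hlim := isSuccLimit_ord hκ
    -- The maximum with `Order.succ k` secures the strict inequality that admissibility demands.
    have hx' : ∀ s ∈ x.supp, s.lev < max η (Order.succ k) :=
      fun s hs => (hx s hs).trans_le (le_max_left _ _)
    have hkη : k < max η (Order.succ k) := (Order.lt_succ k).trans_le (le_max_right _ _)
    have hη' : max η (Order.succ k) < κ.ord := max_lt hη (hlim.succ_lt hk)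
    have hB' : ∀ i j, i ≠ j → ¬ Branch.AgreeBelow k (B' i) (B' j) := fun i j hij h =>
      hB i j hij (((hBB' i).trans h).trans (hBB' j).symm)
    have h1 := (isAdmissible_branches hkη hη' hB).sum_abs_le x
    have h2 := (isAdmissible_branches hkη hη' hB').sum_abs_le x
    rw [sum_apply, UniformSpace.Completion.norm_coe]
    simp only [sub_apply, Branch.functional_coe]
    refine (norm_sum_le _ _).trans ?_
    calc _ ≤ ∑ i, (|segFun {s | s ∈ (B i).nodes ∧ k ≤ s.lev ∧ s.lev ≤ max η (Order.succ k)} x| +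
          |segFun {s | s ∈ (B' i).nodes ∧ k ≤ s.lev ∧ s.lev ≤ max η (Order.succ k)} x|) := by
          refine Finset.sum_le_sum fun i _ => ?_
          rw [Branch.segFun_sub_segFun (hBB' i) hx']
          exact abs_sub _ _
      _ ≤ 2 * √N * ‖x‖ := by
          rw [Finset.sum_add_distrib]
          linarith

end TreeSpace

theorem theorem3p3 (κ : Cardinal.{u}) (hκ : Cardinal.aleph0 ≤ κ) :
    ¬ ∃ A : Set (StrongDual ℝ (TreeSpace.X κ)), A ⊆ TreeSpace.gammaStar κ hκ ∧
      IsEquivalentToL1Basis (Cardinal.lift.{u + 1} (Order.succ κ)) A := by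
  rintro ⟨A, hA, hcard, C₁, C₂, hC₁, -, hl⟩
  choose b hb using fun a : A => hA a.2
  have hinj : Function.Injective b := fun a a' h => Subtype.ext (by rw [← hb a, ← hb a', h])
  obtain ⟨N, hN⟩ := exists_nat_gt (1 / C₁ ^ 2)
  have hNpos : (0 : ℝ) < N := lt_trans (by positivity) hN
  obtain ⟨k, hk, f, g, hfg, hagree, hdis⟩ := TreeSpace.exists_level_pairs hκ hinj
    (by rw [hcard]; exact Cardinal.lift_lt.2 (Order.lt_succ κ)) (Nat.cast_pos.1 hNpos)
  have hup := TreeSpace.norm_sum_functional_sub_le hκ hk hagree hdis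
  -- All `2N` branches are distinct: different pairs have different nodes on level `k`, and `hfg`
  -- separates the members of one pair.
  have hx : Function.Injective (Fin.append f g) := by
    rw [Fin.append_injective_iff]
    refine ⟨fun i j h => ?_, fun i j h => ?_, fun i j h => ?_⟩
    · by_contra hij
      exact hdis i j hij (by rw [h]; exact fun _ _ => rfl)
    · by_contra hij
      exact hdis i j hij ((hagree i).trans (by rw [h]; exact (hagree j).symm))
    · by_cases hij : i = j
      · subst hij
        exact hfg i h
      · exact hdis i j hij (by rw [h]; exact (hagree j).symm)
  -- Coefficients `1` on the `f i` and `-1` on the `g i` have absolute sum `2N`.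
  have hlow := (hl (N + N) (fun i => (Fin.append f g i).1) (Subtype.val_injective.comp hx)
    (fun i => (Fin.append f g i).2) (Fin.append (fun _ => 1) fun _ => -1)).1
  simp only [Fin.sum_univ_add, Fin.append_left, Fin.append_right, abs_one, abs_neg,
    Finset.sum_const, Finset.card_univ, Fintype.card_fin, nsmul_eq_mul, mul_one, one_smul,
    neg_smul] at hlow
  have heq : ∑ i, (f i).1 + ∑ i, -(g i).1 =
      ∑ i, ((b (f i)).functional hκ - (b (g i)).functional hκ) := by
    rw [← Finset.sum_add_distrib]
    refine Finset.sum_congr rfl fun i _ => ?_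
    rw [← sub_eq_add_neg, ← hb (f i), ← hb (g i)]
  rw [heq] at hlow
  have h1 : C₁ * N ≤ √N := by linarith
  have h2 : √(N : ℝ) ^ 2 = N := Real.sq_sqrt hNpos.le
  have h3 : (C₁ * N) ^ 2 ≤ N := by
    rw [← h2]
    gcongr
    simpa [h2] using h1
  rw [div_lt_iff₀ (by positivity)] at hN
  nlinarith
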